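/- Setting. Let $\mathcal C_{p.Lip}(E)$ be the set of functions $\varphi:E\to\mathbb R$ on a normed space $E$ such that, for some $C\ge 0$, $k\in\mathbb N$, $|\varphi(x)-\varphi(y)|\le C(1+\|x\|^k+\|y\|^k)\|x-y\|$ for all $x,y$. Let $\mathcal H^0$ be a linear space of real functions on a set $\Omega$ that contains the constants and contains $\varphi(\xi_1,\dots,\xi_n)$ whenever $\xi_i\in\mathcal H^0$ and $\varphi\in\mathcal C_{p.Lip}(\mathbb R^n)$. Let $\hat{\mathbb E}:\mathcal H^0\to\mathbb R$ be a sublinear expectation, i.e. monotone, with $\hat{\mathbb E}[c]=c$ for constants, subadditive and positively homogeneous, and assume that $\hat{\mathbb E}$ is continuous from below: if $\xi_n,\xi\in\mathcal H^0$ and $\xi_n\uparrow\xi$ pointwise, then $\hat{\mathbb E}[\xi_n]\to\hat{\mathbb E}[\xi]$ (this holds whenever $\hat{\mathbb E}=\sup_{P\in\mathcal P}E_P$ for a family $\mathcal P$ of probability measures). Let $H$ be a real separable Hilbert space. A map $X:\Omega\to E$ is a random variable if $\psi(X)\in\mathcal H^0$ for all $\psi\in\mathcal C_{p.Lip}(E)$.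 Write $X\sim Y$ if $\hat{\mathbb E}[\varphi(X)]=\hat{\mathbb E}[\varphi(Y)]$ for all $\varphi\in\mathcal C_{p.Lip}(E)$. An independent copy of an $H$-valued random variable $X$ is a random variable $\bar X\sim X$ such that $(X,\bar X)$ is an $H\times H$-valued random variable and $\hat{\mathbb E}[\varphi(X,\bar X)]=\hat{\mathbb E}\big[\hat{\mathbb E}[\varphi(x,\bar X)]_{x=X}\big]$ for all $\varphi\in\mathcal C_{p.Lip}(H\times H)$. $X$ is $G$-normal distributed if it has an independent copy and $aX+b\bar X\sim\sqrt{a^2+b^2}\,X$ for every independent copy $\bar X$ of $X$ and all $a,b>0$. We write $X\sim N_G(0,\Sigma)$ if $X$ is $G$-normal distributed and $\Sigma$ is its covariance set, i.e. a convex set of nonnegative symmetric trace class operators on $H$, closed in the trace norm, such that $$\tfrac12\,\hat{\mathbb E}\big[\langle AX,X\rangle\big]=\tfrac12\sup_{Q\in\Sigma}\operatorname{Tr}[AQ]\qquad\text{for every compact symmetric operator }A\text{ on }H.$$ Proposition. There are real constants $c_m,C_m>0$ ($m=1,2,\dots$), depending only on $m$ and with $c_1=C_1=1$, such that for every $X\sim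 N_G(0,\Sigma)$ as above and every integer $m\ge1$ both suprema below are finite and $$c_m\sup_{Q\in\Sigma}\operatorname{Tr}[Q^m]\ \le\ \hat{\mathbb E}\big[\|X\|^{2m}\big]\ \le\ C_m\sup_{Q\in\Sigma}\big(\operatorname{Tr}Q\big)^m .$$ In particular, $\hat{\mathbb E}[\|X\|^2]=\sup_{Q\in\Sigma}\operatorname{Tr}Q$. -/

import Mathlib

open Filter Topology
open scoped InnerProductSpace ENNReal

namespace GExp

/-- The class `C_{p.Lip}(E, F)`: functions that are Lipschitz with polynomially growing constant. -/
def PolyLip {E F : Type*} [NormedAddCommGroup E] [NormedAddCommGroup F] (φ : E → F) : Prop :=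
  ∃ (C : ℝ) (m : ℕ), ∀ x y, ‖φ x - φ y‖ ≤ C * (1 + ‖x‖ ^ m + ‖y‖ ^ m) * ‖x - y‖

/-- A sublinear expectation on a linear space `H0` of real functions on `Ω` that contains the
constants and is stable under `C_{p.Lip}` functions of finitely many variables.
The functional is total for convenience; its values are constrained, and used, only on `H0`. -/
structure SublinearExpectation (Ω : Type*) where
  H0 : Submodule ℝ (Ω → ℝ)
  const_mem : ∀ c : ℝ, (fun _ => c) ∈ H0
  comp_mem : ∀ (n : ℕ) (ξ : Fin n → Ω → ℝ), (∀ i, ξ i ∈ H0) →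
    ∀ φ : (Fin n → ℝ) → ℝ, PolyLip φ → (fun ω => φ (fun i => ξ i ω)) ∈ H0
  expect : (Ω → ℝ) → ℝ
  mono : ∀ ξ ∈ H0, ∀ η ∈ H0, (∀ ω, η ω ≤ ξ ω) → expect η ≤ expect ξ
  const : ∀ c : ℝ, expect (fun _ => c) = c
  subadd : ∀ ξ ∈ H0, ∀ η ∈ H0, expect (ξ + η) ≤ expect ξ + expect η
  pos_hom : ∀ ξ ∈ H0, ∀ l : ℝ, 0 ≤ l → expect (l • ξ) = l * expect ξ

namespace SublinearExpectation

variable {Ω : Type*} (S : SublinearExpectation Ω)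

/-- Monotone continuity from below. Every upper expectation `ξ ↦ sup_{P ∈ 𝒫} E_P[ξ]` over a family
of (countably additive) probability measures has this property. -/
def ContinuousFromBelow : Prop :=
  ∀ (ξ : ℕ → Ω → ℝ) (η : Ω → ℝ), (∀ n, ξ n ∈ S.H0) → η ∈ S.H0 →
    (∀ ω, Monotone fun n => ξ n ω) → (∀ ω, Tendsto (fun n => ξ n ω) atTop (𝓝 (η ω))) →
    Tendsto (fun n => S.expect (ξ n)) atTop (𝓝 (S.expect η))

/-- `X` belongs to the class of `E`-valued random variables of the sublinear expectation space. -/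
def IsRV {E : Type*} [NormedAddCommGroup E] (X : Ω → E) : Prop :=
  ∀ ψ : E → ℝ, PolyLip ψ → (fun ω => ψ (X ω)) ∈ S.H0

/-- `X ∼ Y`. -/
def IdentDistrib {E : Type*} [NormedAddCommGroup E] (X Y : Ω → E) : Prop :=
  ∀ φ : E → ℝ, PolyLip φ → S.expect (fun ω => φ (X ω)) = S.expect (fun ω => φ (Y ω))

/-- `Y` is independent from `X` (this relation is not symmetric). -/
def IsIndepFrom {E : Type*} [NormedAddCommGroup E] (Y X : Ω → E) : Prop :=
  S.IsRV (fun ω => (X ω, Y ω)) ∧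
  ∀ φ : E × E → ℝ, PolyLip φ →
    S.expect (fun ω => φ (X ω, Y ω)) = S.expect (fun ω => S.expect (fun ω' => φ (X ω, Y ω')))

/-- `Y` is an independent copy of `X`. -/
def IsIndepCopy {E : Type*} [NormedAddCommGroup E] (Y X : Ω → E) : Prop :=
  S.IsRV Y ∧ S.IdentDistrib Y X ∧ S.IsIndepFrom Y X

/-- `X` is `G`-normal distributed. An independent copy is required to exist, so that the stability
property is not void. -/
def IsGNormal {E : Type*} [NormedAddCommGroup E] [NormedSpace ℝ E] (X : Ω → E) : Prop :=
  S.IsRV X ∧ (∃ Y : Ω → E, S.IsIndepCopy Y X) ∧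
  ∀ Y : Ω → E, S.IsIndepCopy Y X → ∀ a b : ℝ, 0 < a → 0 < b →
    S.IdentDistrib (fun ω => a • X ω + b • Y ω) (fun ω => √(a ^ 2 + b ^ 2) • X ω)

end SublinearExpectation

section Operators

variable {H : Type*} [NormedAddCommGroup H] [InnerProductSpace ℝ H]

/-- The trace norm, `sup ∑ |⟨T eᵢ, fᵢ⟩|` over finite orthonormal families `(eᵢ)`, `(fᵢ)`. -/
noncomputable def traceNorm (T : H →L[ℝ] H) : ℝ≥0∞ :=
  ⨆ (n : ℕ) (e : Fin n → H) (f : Fin n → H) (_ : Orthonormal ℝ e) (_ : Orthonormal ℝ f),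
    ∑ i, ENNReal.ofReal |⟪T (e i), f i⟫_ℝ|

/-- Membership in the trace class `C_1(H)`. -/
def IsTraceClass (T : H →L[ℝ] H) : Prop := traceNorm T < ⊤

/-- The trace, computed in the orthonormal basis `e`. -/
noncomputable def tr {ι : Type*} (e : HilbertBasis ι ℝ H) (T : H →L[ℝ] H) : ℝ :=
  ∑' i, ⟪T (e i), e i⟫_ℝ

/-- `Sig` is the covariance set of the functional `G` on compact symmetric operators: a convex set
of nonnegative symmetric trace class operators, closed in the trace norm, with
`G(A) = ½ sup_{B ∈ Sig} Tr[A B]` (in particular `Sig` is nonempty). -/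
structure IsCovarianceSet [CompleteSpace H] {ι : Type*} (e : HilbertBasis ι ℝ H)
    (G : (H →L[ℝ] H) → ℝ) (Sig : Set (H →L[ℝ] H)) : Prop where
  traceClass : ∀ B ∈ Sig, IsTraceClass B
  positive : ∀ B ∈ Sig, B.IsPositive
  convex : Convex ℝ Sig
  closed : ∀ B : H →L[ℝ] H, IsTraceClass B →
    (∀ ε : ℝ≥0∞, 0 < ε → ∃ B' ∈ Sig, traceNorm (B - B') < ε) → B ∈ Sig
  isLUB : ∀ A : H →L[ℝ] H, IsCompactOperator A → IsSelfAdjoint A →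
    IsLUB ((fun B => (1 / 2 : ℝ) * tr e (A * B)) '' Sig) (G A)

end Operators

namespace SublinearExpectation

variable {Ω : Type*} (S : SublinearExpectation Ω)
variable {H : Type*} [NormedAddCommGroup H] [InnerProductSpace ℝ H]

/-- The functional `G(A) = ½ Ê[⟨A X, X⟩]`. -/
noncomputable def gFunctional (X : Ω → H) (A : H →L[ℝ] H) : ℝ :=
  (1 / 2 : ℝ) * S.expect (fun ω => ⟪A (X ω), X ω⟫_ℝ)

/-- `X ∼ N_G(0, Sig)`. -/
def IsGNormalWith [CompleteSpace H] {ι : Type*} (e : HilbertBasis ι ℝ H) (X : Ω → H)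
    (Sig : Set (H →L[ℝ] H)) : Prop :=
  S.IsGNormal X ∧ IsCovarianceSet e (S.gFunctional X) Sig

end SublinearExpectation

end GExp

/-! Everything is compared with the second moment `s = Ê‖X‖²`; the constants are `c_m = 1` and `C_m
= momentConst (2m)`. Second moment: finite coordinate projections are compact, so the covariance set
determines the expectation of each finite sum of squared coordinates. These sums increase to `‖X‖²`,
and continuity from below gives `s = sup Tr Q` (`isLUB_tr`). Lower bound: `Tr Q^m ≤ (Tr Q)^m ≤ s^m ≤
Ê‖X‖^(2m)`, by `tr_pow_le` and Jensen. Upper bound: stability with `a = b = 1` and the triangle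
inequality bound `√2^k Ê‖X‖^k` by a binomial sum of products of moments. Its two end terms
contribute `2 Ê‖X‖^k`, which the left side absorbs once `k ≥ 3`; only lower moments remain, so
induction bounds `Ê‖X‖^k` by a constant times `s^(k/2)`. -/

namespace GExp

/-! ### Functions of polynomially bounded Lipschitz growth. -/

section PolyLip

variable {E F : Type*} [NormedAddCommGroup E] [NormedAddCommGroup F]

/-- Powers of the single base `1 + ‖x‖ + ‖y‖ ≥ 1` multiply and compare by exponent, which makes
closure under products a short computation. -/
theorem polyLip_iff {φ : E → F} : PolyLip φ ↔
    ∃ (C : ℝ) (m : ℕ), 0 ≤ C ∧ ∀ x y, ‖φ x - φ y‖ ≤ C * (1 + ‖x‖ + ‖y‖) ^ m * ‖x - y‖ := by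
  constructor
  · rintro ⟨C, m, h⟩
    refine ⟨3 * |C|, m, by positivity, fun x y => (h x y).trans ?_⟩
    refine mul_le_mul_of_nonneg_right ?_ (norm_nonneg _)
    have h1 : (1 : ℝ) ^ m ≤ (1 + ‖x‖ + ‖y‖) ^ m := by
      gcongr; linarith [norm_nonneg x, norm_nonneg y]
    have h2 : ‖x‖ ^ m ≤ (1 + ‖x‖ + ‖y‖) ^ m := by gcongr; linarith [norm_nonneg y]
    have h3 : ‖y‖ ^ m ≤ (1 + ‖x‖ + ‖y‖) ^ m := by gcongr; linarith [norm_nonneg x]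
    rw [one_pow] at h1
    calc C * (1 + ‖x‖ ^ m + ‖y‖ ^ m) ≤ |C| * (1 + ‖x‖ ^ m + ‖y‖ ^ m) := by
          gcongr; exact le_abs_self C
      _ ≤ |C| * (3 * (1 + ‖x‖ + ‖y‖) ^ m) := by gcongr; linarith
      _ = _ := by ring
  · rintro ⟨C, m, hC, h⟩
    refine ⟨C * 3 ^ m, m, fun x y => (h x y).trans ?_⟩
    gcongr ?_ * _
    rw [mul_assoc]
    gcongr
    set M := max 1 (max ‖x‖ ‖y‖) with hM
    have h1 : 1 ≤ M := le_max_left _ _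
    have h2 : ‖x‖ ≤ M := (le_max_left _ _).trans (le_max_right _ _)
    have h3 : ‖y‖ ≤ M := (le_max_right _ _).trans (le_max_right _ _)
    have h4 : M ^ m ≤ 1 + ‖x‖ ^ m + ‖y‖ ^ m := by
      have hx : 0 ≤ ‖x‖ ^ m := by positivity
      have hy : 0 ≤ ‖y‖ ^ m := by positivity
      rcases max_choice 1 (max ‖x‖ ‖y‖) with h | h
      · rw [hM, h, one_pow]; linarith
      · rcases max_choice ‖x‖ ‖y‖ with h' | h' <;> rw [hM, h, h'] <;> linarith
    calc (1 + ‖x‖ + ‖y‖) ^ m ≤ (3 * M) ^ m := by gcongr; linarith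
      _ = 3 ^ m * M ^ m := mul_pow _ _ _
      _ ≤ _ := by gcongr

theorem PolyLip.of_lipschitz {φ : E → F} (K : ℝ) (hK : 0 ≤ K)
    (h : ∀ x y, ‖φ x - φ y‖ ≤ K * ‖x - y‖) : PolyLip φ :=
  polyLip_iff.2 ⟨K, 0, hK, fun x y => by simpa using h x y⟩

theorem polyLip_const (c : F) : PolyLip (fun _ : E => c) :=
  .of_lipschitz 0 le_rfl (by simp)

theorem polyLip_norm : PolyLip (fun x : E => ‖x‖) :=
  .of_lipschitz 1 zero_le_one fun x y => by simpa using abs_norm_sub_norm_le x y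

theorem PolyLip.norm_le {φ : E → F} (h : PolyLip φ) :
    ∃ (C : ℝ) (m : ℕ), 0 ≤ C ∧ ∀ x, ‖φ x‖ ≤ C * (1 + ‖x‖) ^ m := by
  obtain ⟨C, m, hC, h⟩ := polyLip_iff.1 h
  refine ⟨‖φ 0‖ + C, m + 1, by positivity, fun x => ?_⟩
  have h1 : ‖φ x‖ ≤ ‖φ 0‖ + ‖φ x - φ 0‖ := norm_le_norm_add_norm_sub' _ _
  have h2 := h x 0
  have h3 : (1 : ℝ) ≤ (1 + ‖x‖) ^ (m + 1) := one_le_pow₀ (by simp)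
  simp only [norm_zero, add_zero, sub_zero] at h2
  have h4 : C * (1 + ‖x‖) ^ m * ‖x‖ ≤ C * (1 + ‖x‖) ^ (m + 1) := by
    rw [pow_succ, mul_assoc]; gcongr; simp
  nlinarith [norm_nonneg (φ 0)]

theorem PolyLip.mul {f g : E → ℝ} (hf : PolyLip f) (hg : PolyLip g) :
    PolyLip (fun x => f x * g x) := by
  obtain ⟨A, a, hA, hfA⟩ := hf.norm_le
  obtain ⟨B, b, hB, hgB⟩ := hg.norm_le
  obtain ⟨C, m, hC, hfC⟩ := polyLip_iff.1 hf
  obtain ⟨D, n, hD, hgD⟩ := polyLip_iff.1 hg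
  refine polyLip_iff.2 ⟨A * D + B * C, a + n + (b + m), by positivity, fun x y => ?_⟩
  have hx := norm_nonneg x
  have hy := norm_nonneg y
  set R := 1 + ‖x‖ + ‖y‖ with hR
  have hR1 : 1 ≤ R := by linarith
  have h1 : ‖f x‖ ≤ A * R ^ a := (hfA x).trans (by gcongr; linarith)
  have h2 : ‖g y‖ ≤ B * R ^ b := (hgB y).trans (by gcongr; linarith)
  have h3 : R ^ (a + n) ≤ R ^ (a + n + (b + m)) := pow_le_pow_right₀ hR1 (by omega)
  have h4 : R ^ (b + m) ≤ R ^ (a + n + (b + m)) := pow_le_pow_right₀ hR1 (by omega)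
  calc ‖f x * g x - f y * g y‖ = ‖f x * (g x - g y) + g y * (f x - f y)‖ := by congr 1; ring
    _ ≤ ‖f x‖ * ‖g x - g y‖ + ‖g y‖ * ‖f x - f y‖ := by
        rw [← norm_mul, ← norm_mul]; exact norm_add_le _ _
    _ ≤ A * R ^ a * (D * R ^ n * ‖x - y‖) + B * R ^ b * (C * R ^ m * ‖x - y‖) := by
        gcongr
        · exact hgD x y
        · exact hfC x y
    _ = (A * D * R ^ (a + n) + B * C * R ^ (b + m)) * ‖x - y‖ := by ring
    _ ≤ (A * D * R ^ (a + n + (b + m)) + B * C * R ^ (a + n + (b + m))) * ‖x - y‖ := by gcongr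
    _ = _ := by ring

theorem PolyLip.pow {f : E → ℝ} (hf : PolyLip f) (k : ℕ) : PolyLip (fun x => f x ^ k) := by
  induction k with
  | zero => simpa using polyLip_const (1 : ℝ)
  | succ k ih => simpa only [pow_succ] using ih.mul hf

theorem polyLip_norm_fst : PolyLip (fun p : E × F => ‖p.1‖) :=
  .of_lipschitz 1 zero_le_one fun x y => by
    rw [one_mul, Real.norm_eq_abs]
    exact (abs_norm_sub_norm_le x.1 y.1).trans (norm_fst_le (x - y))

theorem polyLip_norm_snd : PolyLip (fun p : E × F => ‖p.2‖) :=
  .of_lipschitz 1 zero_le_one fun x y => by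
    rw [one_mul, Real.norm_eq_abs]
    exact (abs_norm_sub_norm_le x.2 y.2).trans (norm_snd_le (x - y))

theorem polyLip_norm_add : PolyLip (fun p : E × E => ‖p.1 + p.2‖) :=
  .of_lipschitz 2 zero_le_two fun x y => by
    rw [Real.norm_eq_abs]
    refine (abs_norm_sub_norm_le _ _).trans ?_
    have : x.1 + x.2 - (y.1 + y.2) = (x - y).1 + (x - y).2 := by
      simp only [Prod.fst_sub, Prod.snd_sub]; abel
    rw [this]
    linarith [norm_add_le (x - y).1 (x - y).2, norm_fst_le (x - y), norm_snd_le (x - y)]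

theorem polyLip_inner {H : Type*} [NormedAddCommGroup H] [InnerProductSpace ℝ H] (h : H) :
    PolyLip (fun x : H => ⟪h, x⟫_ℝ) :=
  .of_lipschitz ‖h‖ (norm_nonneg h) fun x y => by
    rw [← inner_sub_right]; exact norm_inner_le_norm h (x - y)

end PolyLip

/-! ### Moments under a sublinear expectation and the recursion for `G`-normal variables. -/

namespace SublinearExpectation

variable {Ω : Type*} (S : SublinearExpectation Ω)

theorem expect_sum_le {ι : Type*} (s : Finset ι) (f : ι → Ω → ℝ) (hf : ∀ i, f i ∈ S.H0) :
    S.expect (fun ω => ∑ i ∈ s, f i ω) ≤ ∑ i ∈ s, S.expect (f i) := by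
  classical
  induction s using Finset.induction_on with
  | empty => simp [S.const]
  | insert a s ha ih =>
    simp only [Finset.sum_insert ha]
    have hs : (fun ω => ∑ i ∈ s, f i ω) ∈ S.H0 := by
      have := S.H0.sum_mem (t := s) fun i _ => hf i
      convert this using 1
      ext ω; simp
    exact (S.subadd _ (hf a) _ hs).trans (by linarith)

theorem expect_const_mul {ξ : Ω → ℝ} (hξ : ξ ∈ S.H0) {l : ℝ} (hl : 0 ≤ l) :
    S.expect (fun ω => l * ξ ω) = l * S.expect ξ :=
  S.pos_hom ξ hξ l hl

theorem expect_affine_le {ξ : Ω → ℝ} (hξ : ξ ∈ S.H0) {l : ℝ} (hl : 0 ≤ l) (c : ℝ) :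
    S.expect (fun ω => l * ξ ω + c) ≤ l * S.expect ξ + c := by
  refine (S.subadd (l • ξ) (S.H0.smul_mem l hξ) _ (S.const_mem c)).trans_eq ?_
  rw [S.pos_hom ξ hξ l hl, S.const]

section

variable {S} {E : Type*} [NormedAddCommGroup E]

theorem IsRV.norm_pow_mem {X : Ω → E} (hX : S.IsRV X) (k : ℕ) :
    (fun ω => ‖X ω‖ ^ k) ∈ S.H0 :=
  hX _ (polyLip_norm.pow k)

theorem expect_norm_pow_nonneg {X : Ω → E} (hX : S.IsRV X) (k : ℕ) :
    0 ≤ S.expect (fun ω => ‖X ω‖ ^ k) := by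
  rw [← S.const 0]
  exact S.mono _ (hX.norm_pow_mem k) _ (S.const_mem 0) fun ω => by positivity

/-- Jensen's inequality for the moments of `‖X‖ ^ 2`. -/
theorem pow_expect_norm_sq_le {X : Ω → E} (hX : S.IsRV X) {m : ℕ} (hm : 1 ≤ m) :
    S.expect (fun ω => ‖X ω‖ ^ 2) ^ m ≤ S.expect (fun ω => ‖X ω‖ ^ (2 * m)) := by
  set s := S.expect (fun ω => ‖X ω‖ ^ 2) with hs
  have hs0 : 0 ≤ s := expect_norm_pow_nonneg hX 2
  obtain h0 | h0 := hs0.eq_or_lt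
  · rw [← h0, zero_pow (by omega)]
    exact expect_norm_pow_nonneg hX _
  -- The tangent line to `t ↦ t^m` at `t = s` lies below the graph: Bernoulli's inequality at
  -- `‖X‖²/s`, scaled by `s^m`.
  have key : ∀ ω, ((m : ℝ) * s ^ (m - 1)) * ‖X ω‖ ^ 2
      ≤ 1 * ‖X ω‖ ^ (2 * m) + (m - 1) * s ^ m := by
    intro ω
    have h := one_add_mul_sub_le_pow (a := ‖X ω‖ ^ 2 / s)
      (by have : 0 ≤ ‖X ω‖ ^ 2 / s := by positivity
          linarith) m
    have h' := mul_le_mul_of_nonneg_left h (pow_nonneg h0.le m)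
    rw [div_pow, ← pow_mul, mul_div_cancel₀ _ (by positivity)] at h'
    have e : s ^ m = s ^ (m - 1) * s := by rw [← pow_succ, Nat.sub_add_cancel hm]
    have e2 : s ^ m * (1 + m * (‖X ω‖ ^ 2 / s - 1))
        = (m : ℝ) * s ^ (m - 1) * ‖X ω‖ ^ 2 - (m - 1) * s ^ m := by
      rw [e]; field_simp; ring
    linarith
  have h1 := S.mono (fun ω => 1 * ‖X ω‖ ^ (2 * m) + (m - 1) * s ^ m)
    (S.H0.add_mem (S.H0.smul_mem 1 (hX.norm_pow_mem _)) (S.const_mem _)) _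
    (S.H0.smul_mem ((m : ℝ) * s ^ (m - 1)) (hX.norm_pow_mem 2)) key
  have h2 := S.expect_affine_le (hX.norm_pow_mem (2 * m)) zero_le_one ((m - 1) * s ^ m)
  have h3 := S.pos_hom _ (hX.norm_pow_mem 2) ((m : ℝ) * s ^ (m - 1)) (by positivity)
  rw [← hs, mul_assoc, ← pow_succ, Nat.sub_add_cancel hm] at h3
  linarith [h3.symm.trans_le (h1.trans h2)]

theorem expect_norm_le_sqrt {X : Ω → E} (hX : S.IsRV X) :
    S.expect (fun ω => ‖X ω‖) ≤ √(S.expect (fun ω => ‖X ω‖ ^ 2)) := by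
  set s := S.expect (fun ω => ‖X ω‖ ^ 2) with hs
  have hs0 : 0 ≤ s := expect_norm_pow_nonneg hX 2
  -- Taking `r > √s` keeps `r` positive even when `s = 0`, so that `t ≤ t²/(2r) + r/2` is available.
  refine le_of_forall_gt_imp_ge_of_dense fun r hr => ?_
  have hr0 : 0 < r := (Real.sqrt_nonneg s).trans_lt hr
  have hsr : s ≤ r ^ 2 := (Real.sqrt_le_left hr0.le).1 hr.le
  have key : ∀ ω, ‖X ω‖ ≤ (1 / (2 * r)) * ‖X ω‖ ^ 2 + r / 2 := by
    intro ω
    have : (1 / (2 * r)) * ‖X ω‖ ^ 2 + r / 2 - ‖X ω‖ = (‖X ω‖ - r) ^ 2 / (2 * r) := by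
      field_simp; ring
    have h0 : 0 ≤ (‖X ω‖ - r) ^ 2 / (2 * r) := by positivity
    linarith
  have h1 := S.mono _
    (S.H0.add_mem (S.H0.smul_mem (1 / (2 * r)) (hX.norm_pow_mem 2)) (S.const_mem (r / 2))) _
    (hX _ polyLip_norm) key
  have h2 := S.expect_affine_le (hX.norm_pow_mem 2) (l := 1 / (2 * r)) (by positivity) (r / 2)
  have h3 : 1 / (2 * r) * s ≤ 1 / (2 * r) * r ^ 2 := by gcongr
  have h4 : 1 / (2 * r) * r ^ 2 = r / 2 := by field_simp
  linarith [h1.trans h2]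

/-- Both factors are nonnegative, so positive homogeneity pulls one out of the inner expectation and
the resulting constant out of the outer one. -/
theorem expect_norm_pow_mul_norm_pow {X Y : Ω → E} (hX : S.IsRV X) (h : S.IsIndepCopy Y X)
    (j l : ℕ) : S.expect (fun ω => ‖X ω‖ ^ j * ‖Y ω‖ ^ l)
      = S.expect (fun ω => ‖X ω‖ ^ j) * S.expect (fun ω => ‖X ω‖ ^ l) := by
  obtain ⟨hY, hYX, -, hi⟩ := h
  rw [hi (fun p => ‖p.1‖ ^ j * ‖p.2‖ ^ l) ((polyLip_norm_fst.pow j).mul (polyLip_norm_snd.pow l))]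
  have h1 : ∀ ω, S.expect (fun ω' => ‖X ω‖ ^ j * ‖Y ω'‖ ^ l)
      = S.expect (fun ω => ‖X ω‖ ^ l) * ‖X ω‖ ^ j := fun ω => by
    rw [S.expect_const_mul (hY.norm_pow_mem l) (by positivity), mul_comm,
      hYX _ (polyLip_norm.pow l)]
  simp only [h1]
  rw [S.expect_const_mul (hX.norm_pow_mem j) (expect_norm_pow_nonneg hX l), mul_comm]

/-- Since `X + Y ∼ √2 X`, the left side is `Ê‖X + Y‖^k`; expand `(‖X‖ + ‖Y‖)^k` and factor each term
by independence. -/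
theorem IsGNormal.expect_norm_pow_le [NormedSpace ℝ E] {X : Ω → E} (h : S.IsGNormal X) (k : ℕ) :
    √2 ^ k * S.expect (fun ω => ‖X ω‖ ^ k) ≤ ∑ j ∈ Finset.range (k + 1),
      S.expect (fun ω => ‖X ω‖ ^ j) * S.expect (fun ω => ‖X ω‖ ^ (k - j)) * k.choose j := by
  obtain ⟨hX, ⟨Y, hY⟩, hst⟩ := h
  have hXY := hY.2.2.1
  have h1 := hst Y hY 1 1 one_pos one_pos _ (polyLip_norm.pow k)
  have e2 : (1 : ℝ) ^ 2 + 1 ^ 2 = 2 := by norm_num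
  simp only [one_smul, e2, norm_smul, mul_pow, Real.norm_of_nonneg (Real.sqrt_nonneg 2)] at h1
  rw [S.expect_const_mul (hX.norm_pow_mem k) (by positivity)] at h1
  have hmem : ∀ j, (fun ω => ‖X ω‖ ^ j * ‖Y ω‖ ^ (k - j)) ∈ S.H0 := fun j =>
    hXY (fun p => ‖p.1‖ ^ j * ‖p.2‖ ^ (k - j))
      ((polyLip_norm_fst.pow j).mul (polyLip_norm_snd.pow _))
  have hmem' : ∀ j, (fun ω => (k.choose j : ℝ) * (‖X ω‖ ^ j * ‖Y ω‖ ^ (k - j))) ∈ S.H0 :=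
    fun j => S.H0.smul_mem (k.choose j : ℝ) (hmem j)
  have hsum : (fun ω => ∑ j ∈ Finset.range (k + 1),
      (k.choose j : ℝ) * (‖X ω‖ ^ j * ‖Y ω‖ ^ (k - j))) ∈ S.H0 := by
    have := S.H0.sum_mem (t := Finset.range (k + 1)) fun j _ => hmem' j
    convert this using 1
    ext ω; simp
  rw [← h1]
  refine (S.mono _ hsum _ (hXY _ (polyLip_norm_add.pow k)) fun ω => ?_).trans
    ((S.expect_sum_le _ _ hmem').trans_eq ?_)
  · calc ‖X ω + Y ω‖ ^ k ≤ (‖X ω‖ + ‖Y ω‖) ^ k := by gcongr; exact norm_add_le _ _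
      _ = _ := by rw [add_pow]; exact Finset.sum_congr rfl fun j _ => by ring
  · refine Finset.sum_congr rfl fun j _ => ?_
    rw [S.expect_const_mul (hmem j) (by positivity), expect_norm_pow_mul_norm_pow hX hY, mul_comm]

end

end SublinearExpectation

/-- Constants `K k` with `Ê[‖X‖ ^ k] ≤ K k * Ê[‖X‖ ^ 2] ^ (k / 2)` for `G`-normal `X`. -/
noncomputable def momentConst (k : ℕ) : ℝ :=
  if k ≤ 2 then 1 else
    (∑ j : Fin (k - 1), momentConst (j + 1) * momentConst (k - (j + 1)) * k.choose (j + 1))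
      / (√2 ^ k - 2)
termination_by k
decreasing_by all_goals omega

theorem momentConst_of_le {k : ℕ} (hk : k ≤ 2) : momentConst k = 1 := by
  rw [momentConst, if_pos hk]

theorem momentConst_add_three (k : ℕ) : momentConst (k + 3) =
    (∑ j ∈ Finset.range (k + 2),
      momentConst (j + 1) * momentConst (k + 3 - (j + 1)) * (k + 3).choose (j + 1))
      / (√2 ^ (k + 3) - 2) := by
  rw [momentConst, if_neg (by omega)]
  congr 1
  exact Fin.sum_univ_eq_sum_range (fun j =>
    momentConst (j + 1) * momentConst (k + 3 - (j + 1)) * ((k + 3).choose (j + 1) : ℝ)) (k + 2)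

/-- Three is the first exponent at which the two end terms can be absorbed: at exponent 2 equality
holds, which is why moments up to order 2 are base cases. -/
theorem two_lt_sqrt_two_pow (k : ℕ) : 2 < √2 ^ (k + 3) := by
  have h1 : (1 : ℝ) < √2 := by rw [Real.lt_sqrt] <;> norm_num
  have h2 : √2 ^ 2 = (2 : ℝ) := Real.sq_sqrt zero_le_two
  calc (2 : ℝ) = √2 ^ 2 := h2.symm
    _ < √2 ^ (k + 3) := pow_lt_pow_right₀ h1 (by omega)

theorem momentConst_pos (k : ℕ) : 0 < momentConst k := by
  induction k using Nat.strong_induction_on with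
  | _ k ih =>
    rcases le_or_gt k 2 with hk | hk
    · rw [momentConst_of_le hk]; exact one_pos
    · obtain ⟨k, rfl⟩ := Nat.exists_eq_add_of_le' hk
      rw [Nat.succ_eq_add_one, momentConst_add_three]
      refine div_pos (Finset.sum_pos (fun j hj => ?_) ⟨0, by simp⟩)
        (sub_pos.2 (two_lt_sqrt_two_pow k))
      rw [Finset.mem_range] at hj
      have h1 := ih (j + 1) (by omega)
      have h2 := ih (k + 3 - (j + 1)) (by omega)
      have h3 : 0 < (k + 3).choose (j + 1) := Nat.choose_pos (by omega)
      positivity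

/-- Kahane-type moment comparison for `G`-normal random variables. -/
theorem SublinearExpectation.IsGNormal.expect_norm_pow_le_momentConst {Ω E : Type*}
    {S : SublinearExpectation Ω} [NormedAddCommGroup E] [NormedSpace ℝ E] {X : Ω → E}
    (h : S.IsGNormal X) (k : ℕ) :
    S.expect (fun ω => ‖X ω‖ ^ k)
      ≤ momentConst k * √(S.expect (fun ω => ‖X ω‖ ^ 2)) ^ k := by
  induction k using Nat.strong_induction_on with
  | _ k ih =>
    rcases le_or_gt k 2 with hk | hk
    · rw [momentConst_of_le hk, one_mul]
      interval_cases k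
      · simp [S.const]
      · simpa using expect_norm_le_sqrt h.1
      · rw [Real.sq_sqrt (expect_norm_pow_nonneg h.1 2)]
    · obtain ⟨k, rfl⟩ := Nat.exists_eq_add_of_le' hk
      rw [Nat.succ_eq_add_one] at ih ⊢
      set s := √(S.expect (fun ω => ‖X ω‖ ^ 2)) with hs
      have h1 := h.expect_norm_pow_le (k + 3)
      -- Splits off the last and first terms, each equal to `Ê‖X‖^(k+3)`; both exponents in every
      -- remaining term are below `k + 3`.
      rw [Finset.sum_range_succ, Finset.sum_range_succ'] at h1
      simp only [pow_zero, S.const, Nat.choose_self, Nat.choose_zero_right, Nat.sub_self,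
        Nat.sub_zero, Nat.cast_one, mul_one, one_mul] at h1
      have h2 : ∑ j ∈ Finset.range (k + 2), S.expect (fun ω => ‖X ω‖ ^ (j + 1)) *
          S.expect (fun ω => ‖X ω‖ ^ (k + 3 - (j + 1))) * ((k + 3).choose (j + 1) : ℝ)
          ≤ (∑ j ∈ Finset.range (k + 2),
      momentConst (j + 1) * momentConst (k + 3 - (j + 1)) * (k + 3).choose (j + 1))
            * s ^ (k + 3) := by
        rw [Finset.sum_mul]
        refine Finset.sum_le_sum fun j hj => ?_
        rw [Finset.mem_range] at hj
        have e : s ^ (k + 3) = s ^ (j + 1) * s ^ (k + 3 - (j + 1)) := by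
          rw [← pow_add]; congr 1; omega
        have hc := momentConst_pos (j + 1)
        calc _ ≤ (momentConst (j + 1) * s ^ (j + 1)) *
              (momentConst (k + 3 - (j + 1)) * s ^ (k + 3 - (j + 1)))
                * ((k + 3).choose (j + 1) : ℝ) := by
              gcongr
              · exact expect_norm_pow_nonneg h.1 _
              · exact ih _ (by omega)
              · exact ih _ (by omega)
          _ = _ := by rw [e]; ring
      have h3 := two_lt_sqrt_two_pow k
      rw [momentConst_add_three, div_mul_eq_mul_div, le_div_iff₀ (by linarith)]
      linarith

/-! ### Traces of positive trace class operators and their powers. -/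

section Trace

variable {H : Type*} [NormedAddCommGroup H] [InnerProductSpace ℝ H] {ι : Type*}

/-- Basis vectors are `√2` apart, so balls of radius `1/2` around them are disjoint. Countability
lets a sequence of finite sets exhaust the basis, as continuity from below requires. -/
theorem _root_.HilbertBasis.countable_of_separable [TopologicalSpace.SeparableSpace H]
    (e : HilbertBasis ι ℝ H) : Countable ι := by
  have hd : (Set.univ : Set ι).PairwiseDisjoint fun i => Metric.ball (e i) (1 / 2) := by
    intro i _ j _ hij
    refine Metric.ball_disjoint_ball ?_
    have h1 : ‖e i - e j‖ ^ 2 = 2 := by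
      rw [norm_sub_sq_real, e.orthonormal.1 i, e.orthonormal.1 j, e.orthonormal.2 hij]; norm_num
    rw [dist_eq_norm]
    nlinarith [norm_nonneg (e i - e j)]
  exact Set.countable_univ_iff.1 (hd.countable_of_isOpen (fun i _ => Metric.isOpen_ball)
    fun i _ => ⟨e i, Metric.mem_ball_self (by norm_num)⟩)

theorem IsTraceClass.summable {T : H →L[ℝ] H} (hT : IsTraceClass T) (e : HilbertBasis ι ℝ H) :
    Summable fun i => ⟪T (e i), e i⟫_ℝ := by
  refine Summable.of_abs ?_
  refine summable_of_sum_le (c := (traceNorm T).toReal) (fun i => abs_nonneg _) fun s => ?_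
  have ho : Orthonormal ℝ fun k : Fin s.card => e (s.equivFin.symm k) :=
    e.orthonormal.comp _ (Subtype.val_injective.comp s.equivFin.symm.injective)
  have h1 : ∑ k : Fin s.card, ENNReal.ofReal
      |⟪T (e (s.equivFin.symm k)), e (s.equivFin.symm k)⟫_ℝ| ≤ traceNorm T :=
    le_iSup_of_le s.card <| le_iSup_of_le _ <| le_iSup_of_le _ <| le_iSup_of_le ho <|
      le_iSup_of_le ho le_rfl
  rw [← ENNReal.ofReal_sum_of_nonneg fun _ _ => abs_nonneg _,
    Equiv.sum_comp s.equivFin.symm fun i : s => |⟪T (e i), e i⟫_ℝ|,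
    Finset.sum_coe_sort s fun i => |⟪T (e i), e i⟫_ℝ|] at h1
  exact (ENNReal.ofReal_le_iff_le_toReal hT.ne).1 h1

theorem inner_nonneg_of_isPositive {Q : H →L[ℝ] H} (hQ : Q.IsPositive) (x : H) :
    0 ≤ ⟪Q x, x⟫_ℝ := by
  simpa using hQ.re_inner_nonneg_left x

/-- Cauchy–Schwarz for the form of `Q`, from the discriminant of `t ↦ ⟪Q (x + t y), x + t y⟫`. -/
theorem inner_sq_le_of_isPositive {Q : H →L[ℝ] H} (hQ : Q.IsPositive) (x y : H) :
    ⟪Q x, y⟫_ℝ ^ 2 ≤ ⟪Q x, x⟫_ℝ * ⟪Q y, y⟫_ℝ := by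
  have h : ∀ t : ℝ, 0 ≤ ⟪Q y, y⟫_ℝ * (t * t) + 2 * ⟪Q x, y⟫_ℝ * t + ⟪Q x, x⟫_ℝ := by
    intro t
    have h1 := inner_nonneg_of_isPositive hQ (x + t • y)
    have h2 : ⟪Q y, x⟫_ℝ = ⟪Q x, y⟫_ℝ := by
      rw [hQ.inner_left_eq_inner_right, real_inner_comm]
    simp only [map_add, map_smul, inner_add_left, inner_add_right, real_inner_smul_left,
      real_inner_smul_right, h2] at h1
    linarith
  have := discrim_le_zero h
  rw [discrim] at this
  linarith

variable {Q : H →L[ℝ] H} (hQ : Q.IsPositive) (hT : IsTraceClass Q) (e : HilbertBasis ι ℝ H)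
include hQ

theorem tr_nonneg_of_isPositive : 0 ≤ tr e Q :=
  tsum_nonneg fun i => inner_nonneg_of_isPositive hQ (e i)

include hT

/-- Parseval for `Q x`, with Cauchy–Schwarz for the form of `Q` applied to each coefficient. -/
theorem norm_sq_le_tr_mul (x : H) : ‖Q x‖ ^ 2 ≤ tr e Q * ⟪Q x, x⟫_ℝ := by
  have h1 := e.hasSum_inner_mul_inner (Q x) (Q x)
  rw [real_inner_self_eq_norm_sq] at h1
  refine hasSum_le (fun i => ?_) h1 ((hT.summable e).hasSum.mul_right ⟪Q x, x⟫_ℝ)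
  rw [real_inner_comm (Q x) (e i), ← sq, mul_comm ⟪Q (e i), e i⟫_ℝ]
  exact inner_sq_le_of_isPositive hQ x (e i)

theorem norm_apply_le_tr_mul (x : H) : ‖Q x‖ ≤ tr e Q * ‖x‖ := by
  have h0 := tr_nonneg_of_isPositive hQ e
  rcases (norm_nonneg (Q x)).eq_or_lt with h | h
  · rw [← h]; positivity
  · have h1 := norm_sq_le_tr_mul hQ hT e x
    have h2 : tr e Q * ⟪Q x, x⟫_ℝ ≤ tr e Q * (‖Q x‖ * ‖x‖) := by
      gcongr; exact real_inner_le_norm _ _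
    refine le_of_mul_le_mul_left ?_ h
    linarith

/-- Moving one factor `Q` across the inner product lowers the exponent by two and replaces `x` by `Q
x`, hence the two-step induction; no spectral theorem enters. -/
theorem inner_pow_apply_bounds (m : ℕ) : ∀ x, 0 ≤ ⟪(Q ^ (m + 1)) x, x⟫_ℝ ∧
    ⟪(Q ^ (m + 1)) x, x⟫_ℝ ≤ tr e Q ^ m * ⟪Q x, x⟫_ℝ := by
  have h0 := tr_nonneg_of_isPositive hQ e
  induction m using Nat.twoStepInduction with
  | zero => intro x; simp [inner_nonneg_of_isPositive hQ x]
  | one =>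
    intro x
    have : ⟪(Q ^ (1 + 1)) x, x⟫_ℝ = ‖Q x‖ ^ 2 := by
      rw [pow_succ, pow_one, mul_apply_eq_comp, hQ.inner_left_eq_inner_right,
        real_inner_self_eq_norm_sq]
    rw [this, pow_one]
    exact ⟨by positivity, norm_sq_le_tr_mul hQ hT e x⟩
  | more m ih _ =>
    intro x
    have h1 : ⟪(Q ^ (m + 2 + 1)) x, x⟫_ℝ = ⟪(Q ^ (m + 1)) (Q x), Q x⟫_ℝ := by
      rw [pow_succ', pow_succ, mul_apply_eq_comp, hQ.inner_left_eq_inner_right,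
        mul_apply_eq_comp]
    rw [h1]
    refine ⟨(ih (Q x)).1, (ih (Q x)).2.trans ?_⟩
    have h2 : ⟪Q (Q x), Q x⟫_ℝ ≤ tr e Q * ‖Q x‖ ^ 2 :=
      (real_inner_le_norm _ _).trans (by
        rw [sq, ← mul_assoc]; gcongr; exact norm_apply_le_tr_mul hQ hT e (Q x))
    calc tr e Q ^ m * ⟪Q (Q x), Q x⟫_ℝ
        ≤ tr e Q ^ m * (tr e Q * (tr e Q * ⟪Q x, x⟫_ℝ)) := by
          gcongr
          exact h2.trans (by gcongr; exact norm_sq_le_tr_mul hQ hT e x)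
      _ = _ := by ring

theorem tr_pow_le {m : ℕ} (hm : 1 ≤ m) : tr e (Q ^ m) ≤ tr e Q ^ m := by
  obtain ⟨m, rfl⟩ := Nat.exists_eq_add_of_le' hm
  have hs := (hT.summable e).mul_left (tr e Q ^ m)
  have hb := fun i => inner_pow_apply_bounds hQ hT e m (e i)
  calc tr e (Q ^ (m + 1)) ≤ ∑' i, tr e Q ^ m * ⟪Q (e i), e i⟫_ℝ :=
        (hs.of_nonneg_of_le (fun i => (hb i).1) fun i => (hb i).2).tsum_le_tsum
          (fun i => (hb i).2) hs
    _ = tr e Q ^ (m + 1) := by rw [tsum_mul_left, pow_succ]; rfl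

end Trace

/-! ### Finite coordinate projections as test operators. -/

section CoordProj

variable {H : Type*} [NormedAddCommGroup H] [InnerProductSpace ℝ H] {ι : Type*}
  (e : HilbertBasis ι ℝ H) (s : Finset ι)

/-- The orthogonal projection to the span of the basis vectors `e i`, `i ∈ s`. -/
noncomputable def coordProj : H →L[ℝ] H :=
  ∑ i ∈ s, InnerProductSpace.rankOne ℝ (e i) (e i)

theorem inner_coordProj_left (x y : H) :
    ⟪coordProj e s x, y⟫_ℝ = ∑ i ∈ s, ⟪e i, x⟫_ℝ * ⟪e i, y⟫_ℝ := by
  simp [coordProj, sum_inner, real_inner_smul_left]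

theorem isSelfAdjoint_coordProj [CompleteSpace H] : IsSelfAdjoint (coordProj e s) :=
  isSelfAdjoint_sum s fun i _ => (InnerProductSpace.isPositive_rankOne_self (e i)).isSelfAdjoint

theorem isCompactOperator_coordProj : IsCompactOperator (coordProj e s) := by
  have h1 : ∀ i, InnerProductSpace.rankOne ℝ (e i) (e i) ∈
      compactOperator (RingHom.id ℝ) H H := fun i =>
    (isCompactOperator_of_locallyCompactSpace_dom (innerSL ℝ (e i))).clm_comp
      (ContinuousLinearMap.toSpanSingleton ℝ (e i))
  exact (compactOperator (RingHom.id ℝ) H H).sum_mem fun i _ => h1 i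

theorem tr_coordProj_mul (Q : H →L[ℝ] H) :
    tr e (coordProj e s * Q) = ∑ i ∈ s, ⟪Q (e i), e i⟫_ℝ := by
  classical
  have h : ∀ i, ⟪(coordProj e s * Q) (e i), e i⟫_ℝ
      = if i ∈ s then ⟪Q (e i), e i⟫_ℝ else 0 := by
    intro i
    rw [mul_apply_eq_comp, inner_coordProj_left]
    simp [orthonormal_iff_ite.1 e.orthonormal, real_inner_comm]
  rw [tr, tsum_congr h, tsum_eq_sum (s := s) fun i hi => if_neg hi]
  exact Finset.sum_congr rfl fun i hi => if_pos hi

end CoordProj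

/-! ### The second moment as the supremum of traces. -/

section Covariance

variable {Ω : Type*} {S : SublinearExpectation Ω} {H : Type*} [NormedAddCommGroup H]
  [InnerProductSpace ℝ H] {ι : Type*} (e : HilbertBasis ι ℝ H)

theorem SublinearExpectation.IsRV.sum_inner_sq_mem {X : Ω → H} (hX : S.IsRV X) (s : Finset ι) :
    (fun ω => ∑ i ∈ s, ⟪e i, X ω⟫_ℝ * ⟪e i, X ω⟫_ℝ) ∈ S.H0 := by
  have := S.H0.sum_mem (t := s) fun i _ =>
    hX _ ((polyLip_inner (e i)).mul (polyLip_inner (e i)))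
  convert this using 1
  ext ω; simp

theorem hasSum_inner_mul_inner_self (x : H) :
    HasSum (fun i => ⟪e i, x⟫_ℝ * ⟪e i, x⟫_ℝ) (‖x‖ ^ 2) := by
  have := e.hasSum_inner_mul_inner x x
  rw [real_inner_self_eq_norm_sq] at this
  exact this.congr_fun fun i => by rw [real_inner_comm]

variable [CompleteSpace H] {X : Ω → H} {Sig : Set (H →L[ℝ] H)}

theorem IsCovarianceSet.isLUB_sum (hS : IsCovarianceSet e (S.gFunctional X) Sig) (s : Finset ι) :
    IsLUB ((fun Q : H →L[ℝ] H => ∑ i ∈ s, ⟪Q (e i), e i⟫_ℝ) '' Sig)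
      (S.expect fun ω => ∑ i ∈ s, ⟪e i, X ω⟫_ℝ * ⟪e i, X ω⟫_ℝ) := by
  have h := hS.isLUB _ (isCompactOperator_coordProj e s) (isSelfAdjoint_coordProj e s)
  simp only [SublinearExpectation.gFunctional, inner_coordProj_left, tr_coordProj_mul] at h
  constructor
  · rintro _ ⟨Q, hQ, rfl⟩
    have := h.1 ⟨Q, hQ, rfl⟩
    simp only at this ⊢
    linarith
  · intro b hb
    have : _ ≤ 1 / 2 * b := h.2 <| by
      rintro _ ⟨Q, hQ, rfl⟩
      have := hb ⟨Q, hQ, rfl⟩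
      simp only at this ⊢
      linarith
    linarith

/-- The empty set has no least upper bound in `ℝ`. -/
theorem IsCovarianceSet.nonempty (hS : IsCovarianceSet e (S.gFunctional X) Sig) :
    Sig.Nonempty :=
  Set.image_nonempty.1 (hS.isLUB_sum e ∅).nonempty

theorem IsCovarianceSet.isLUB_tr [TopologicalSpace.SeparableSpace H]
    (hc : S.ContinuousFromBelow) (hX : S.IsRV X)
    (hS : IsCovarianceSet e (S.gFunctional X) Sig) :
    IsLUB ((fun Q => tr e Q) '' Sig) (S.expect fun ω => ‖X ω‖ ^ 2) := by
  have := e.countable_of_separable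
  constructor
  · rintro _ ⟨Q, hQ, rfl⟩
    refine ((hS.traceClass Q hQ).summable e).tsum_le_of_sum_le fun s => ?_
    refine ((hS.isLUB_sum e s).1 ⟨Q, hQ, rfl⟩).trans ?_
    exact S.mono _ (hX.norm_pow_mem 2) _ (hX.sum_inner_sq_mem e s) fun ω =>
      sum_le_hasSum s (fun i _ => mul_self_nonneg _) (hasSum_inner_mul_inner_self e (X ω))
  · intro b hb
    obtain ⟨s, hs, hst⟩ := exists_seq_monotone_tendsto_atTop_atTop (Finset ι)
    -- Continuity from below along partial Parseval sums; each partial expectation is a supremum of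
    -- partial traces, hence at most `b`.
    refine le_of_tendsto' (hc (fun n ω => ∑ i ∈ s n, ⟪e i, X ω⟫_ℝ * ⟪e i, X ω⟫_ℝ) _
      (fun n => hX.sum_inner_sq_mem e (s n)) (hX.norm_pow_mem 2)
      (fun ω m n hmn => Finset.sum_le_sum_of_subset_of_nonneg (hs hmn)
        fun i _ _ => mul_self_nonneg _)
      fun ω => (hasSum_inner_mul_inner_self e (X ω)).comp hst) fun n => ?_
    refine (hS.isLUB_sum e (s n)).2 ?_
    rintro _ ⟨Q, hQ, rfl⟩
    exact (((hS.traceClass Q hQ).summable e).sum_le_tsum _ fun i _ =>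
      inner_nonneg_of_isPositive (hS.positive Q hQ) (e i)).trans (hb ⟨Q, hQ, rfl⟩)

/-- Traces on `Sig` are nonnegative, so the power is monotone there, and its continuity along a
maximizing sequence carries the supremum through. -/
theorem IsCovarianceSet.isLUB_tr_pow [TopologicalSpace.SeparableSpace H]
    (hc : S.ContinuousFromBelow) (hX : S.IsRV X)
    (hS : IsCovarianceSet e (S.gFunctional X) Sig) (m : ℕ) :
    IsLUB ((fun Q => tr e Q ^ m) '' Sig) (S.expect (fun ω => ‖X ω‖ ^ 2) ^ m) := by
  have h := hS.isLUB_tr e hc hX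
  have h0 : ∀ Q ∈ Sig, 0 ≤ tr e Q := fun Q hQ => tr_nonneg_of_isPositive (hS.positive Q hQ) e
  obtain ⟨u, -, -, hu, hum⟩ := h.exists_seq_monotone_tendsto ((hS.nonempty e).image _)
  constructor
  · rintro _ ⟨Q, hQ, rfl⟩
    exact pow_le_pow_left₀ (h0 Q hQ) (h.1 ⟨Q, hQ, rfl⟩) m
  · intro b hb
    refine le_of_tendsto' (hu.pow m) fun n => ?_
    obtain ⟨Q, hQ, hQn⟩ := hum n
    rw [← hQn]
    exact hb ⟨Q, hQ, rfl⟩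

end Covariance

end GExp

/-! ### The two-sided moment estimate. -/

theorem mainTheorem12 :
    ∃ c C : ℕ → ℝ, (∀ m, 1 ≤ m → 0 < c m ∧ 0 < C m) ∧ c 1 = 1 ∧ C 1 = 1 ∧
      ∀ (Ω : Type*) (H : Type*) [NormedAddCommGroup H] [InnerProductSpace ℝ H] [CompleteSpace H]
        [TopologicalSpace.SeparableSpace H] (ι : Type*) (e : HilbertBasis ι ℝ H)
        (S : GExp.SublinearExpectation Ω), S.ContinuousFromBelow →
        ∀ (X : Ω → H) (Sig : Set (H →L[ℝ] H)), S.IsGNormalWith e X Sig →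
          (∀ m : ℕ, 1 ≤ m →
            BddAbove ((fun Q => GExp.tr e (Q ^ m)) '' Sig) ∧
            BddAbove ((fun Q => GExp.tr e Q ^ m) '' Sig) ∧
            c m * sSup ((fun Q => GExp.tr e (Q ^ m)) '' Sig)
              ≤ S.expect (fun ω => ‖X ω‖ ^ (2 * m)) ∧
            S.expect (fun ω => ‖X ω‖ ^ (2 * m))
              ≤ C m * sSup ((fun Q => GExp.tr e Q ^ m) '' Sig)) ∧
          IsLUB ((fun Q => GExp.tr e Q) '' Sig) (S.expect (fun ω => ‖X ω‖ ^ 2)) := by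
  refine ⟨fun _ => 1, fun m => GExp.momentConst (2 * m),
    fun m _ => ⟨one_pos, GExp.momentConst_pos _⟩, rfl, GExp.momentConst_of_le le_rfl, ?_⟩
  intro Ω H _ _ _ _ ι e S hc X Sig ⟨hN, hS⟩
  refine ⟨fun m hm => ?_, hS.isLUB_tr e hc hN.1⟩
  have hne := hS.nonempty e
  have hlub := hS.isLUB_tr_pow e hc hN.1 m
  have hub : S.expect (fun ω => ‖X ω‖ ^ 2) ^ m ∈
      upperBounds ((fun Q => GExp.tr e (Q ^ m)) '' Sig) := by
    rintro _ ⟨Q, hQ, rfl⟩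
    exact (GExp.tr_pow_le (hS.positive Q hQ) (hS.traceClass Q hQ) e hm).trans
      (hlub.1 ⟨Q, hQ, rfl⟩)
  refine ⟨⟨_, hub⟩, ⟨_, hlub.1⟩, ?_, ?_⟩
  · rw [one_mul]
    exact (csSup_le (hne.image _) hub).trans
      (GExp.SublinearExpectation.pow_expect_norm_sq_le hN.1 hm)
  · rw [hlub.csSup_eq (hne.image _)]
    have h := hN.expect_norm_pow_le_momentConst (2 * m)
    rwa [pow_mul (√_), Real.sq_sqrt
      (GExp.SublinearExpectation.expect_norm_pow_nonneg hN.1 2)] at h
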